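/- Let $q$ be a prime power with $q\equiv 1\pmod 6$, and let $\widehat{\mathbb F_q^\times}$ be the group of characters $\mathbb F_q^\times\to\mathbb C^\times$, each extended to $\mathbb F_q$ by the value $0$ at $0$ (also for the trivial character $\varepsilon$). Write $\overline A=A^{-1}$ for the complex conjugate character, let $\phi$ be the quadratic character, and let $J(A,B)=\sum_{x\in\mathbb F_q}A(x)B(1-x)$ be the Jacobi sum. For characters $A_1,\dots,A_{n+1},B_1,\dots,B_n$ and $\lambda\in\mathbb F_q$ define inductively ${}_1\mathbb P_0[A;\lambda]=\overline A(1-\lambda)$ and $${}_{n+1}\mathbb P_n\left[\begin{matrix}A_1&\cdots&A_{n+1}\\&B_1\ \cdots&B_n\end{matrix};\lambda\right]=\sum_{y\in\mathbb F_q}A_{n+1}(y)\,\overline{A_{n+1}}B_n(1-y)\;{}_{n}\mathbb P_{n-1}\left[\begin{matrix}A_1&\cdots&A_{n}\\&B_1\ \cdots&B_{n-1}\end{matrix};\lambda y\right],$$ and let $${}_{n+1}\mathbb F_n\left[\begin{matrix}A_1&\cdots&A_{n+1}\\&B_1\ \cdots&B_n\end{matrix};\lambda\right]=\frac{1}{\prod_{i=1}^nJ(A_{i+1},B_i\overline{A_{i+1}})}\;{}_{n+1}\mathbb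 P_n\left[\begin{matrix}A_1&\cdots&A_{n+1}\\&B_1\ \cdots&B_n\end{matrix};\lambda\right].$$ Let $A,\chi,\eta_3\in\widehat{\mathbb F_q^\times}$ be such that $\eta_3$ has order $3$ and none of $A^6,\ \chi^6,\ (A\chi)^3,\ (\overline A\chi)^3$ is the trivial character. Then $${}_3\mathbb F_2\left[\begin{matrix}A^3&\overline A^3&\overline\chi\\&\phi&\overline\chi^3\end{matrix};\frac34\right]=\sum_{\substack{B\in\widehat{\mathbb F_q^\times}\\B^3=A^3}}\frac{J(B\chi,\eta_3)\,J(\overline B\chi,\overline{\eta_3})}{J(B,\chi\eta_3)\,J(\overline B,\chi\overline{\eta_3})}=A(-1)\sum_{\substack{B\in\widehat{\mathbb F_q^\times}\\B^3=A^3}}\frac{J(B\chi,\overline B\chi)}{J(\eta_3\chi,\chi\overline{\eta_3})}.$$ -/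

import Mathlib

noncomputable section

/-- The finite-field period function
`ₙ₊₁ℙₙ[A₁, …, Aₙ₊₁; B₁, …, Bₙ; lam]`, defined inductively by `₁ℙ₀[A; lam] = Ā(1 - lam)` and
`ₙ₊₁ℙₙ[A₁, …, Aₙ₊₁; B₁, …, Bₙ; lam]
  = ∑ y, Aₙ₊₁(y) (Āₙ₊₁ Bₙ)(1 - y) ₙℙₙ₋₁[A₁, …, Aₙ; B₁, …, Bₙ₋₁; lam y]`.
The conjugate `Ā` of a complex character is its inverse `A⁻¹`; every `MulChar`, including the
trivial one, vanishes at `0`. -/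
def ffPeriod {F : Type*} [Field F] [Fintype F] :
    (n : ℕ) → (Fin (n + 1) → MulChar F ℂ) → (Fin n → MulChar F ℂ) → F → ℂ
  | 0, A, _, lam => (A 0)⁻¹ (1 - lam)
  | n + 1, A, B, lam =>
      ∑ y : F, A (Fin.last (n + 1)) y * ((A (Fin.last (n + 1)))⁻¹ * B (Fin.last n)) (1 - y) *
        ffPeriod n (fun i => A i.castSucc) (fun i => B i.castSucc) (lam * y)

/-- The normalized finite-field hypergeometric function
`ₙ₊₁𝔽ₙ[A₁, …, Aₙ₊₁; B₁, …, Bₙ; lam]`: the period function divided by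
`∏ᵢ J(Aᵢ₊₁, Bᵢ Āᵢ₊₁)`. -/
def ffHyp {F : Type*} [Field F] [Fintype F] (n : ℕ)
    (A : Fin (n + 1) → MulChar F ℂ) (B : Fin n → MulChar F ℂ) (lam : F) : ℂ :=
  1 / (∏ i : Fin n, jacobiSum (A i.succ) (B i * (A i.succ)⁻¹)) * ffPeriod n A B lam

/-- The quadratic character of a finite field, with complex values. -/
def quadCharC (F : Type*) [Field F] [Fintype F] [DecidableEq F] : MulChar F ℂ :=
  (quadraticChar F).ringHomComp (Int.castRingHom ℂ)

/-- The finite set of complex characters `B` with `B ^ 3 = A ^ 3`. -/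
def cubeFiber {F : Type*} [Field F] [Fintype F] (A : MulChar F ℂ) : Finset (MulChar F ℂ) :=
  (Set.toFinite {B : MulChar F ℂ | B ^ 3 = A ^ 3}).toFinset

end

/-! The function ₂F₁(a, -a; 1/2; λ) is a Chebyshev-type function, and its finite-field analogue is
again explicit: with `C = A ^ 3`, the inner `₂ℙ₁` sum at `λ` is a Jacobi sum times the sum of `C z`
over the roots of `z + z⁻¹ = 2 - 4λ` (`sum_period_eq`). The point `3/4` is special because `λ =
3y/4` gives `y = -(1 - z)² / (3z)` and `1 - y = (1 + z + z²) / (3z)`, so the outer weight, a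
character of `y(1 - y)²`, depends only on `z³` (`sum_period_three_quarters`). Since `C * χ ^ 3` is a
cube, the whole sum runs over `z³`, and cubic characters unfold it into Jacobi sums indexed by the
`B` with `B ^ 3 = A ^ 3` (`sum_cube_eq_sum_cubeFiber`).

The normalizing factor `J(χ⁻¹, χ⁻²)` is brought to the stated form by the cubic Hasse–Davenport
relation (`jacobiSum_triplication`), proved here by counting fibres of the Dickson polynomial `v³ -
3v`. The two sums over `B` agree term by term, by Gauss sums (`jacobiSum_ratio_eq`). -/

/-! ### Jacobi sum reflection and cubic characters -/

lemma jacobiSum_eq_apply_neg_one_mul {F : Type*} [Field F] [Fintype F] (a b : MulChar F ℂ) :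
    jacobiSum a b = a (-1) * jacobiSum a (a * b)⁻¹ := by
  -- The substitution `x = u / (u - 1)`, written so that it is a bijection of `F`: the pole `u = 1`
  -- goes to `x = 1`, where both summands vanish.
  have hinj : Function.Injective (fun u : F => 1 + (u - 1)⁻¹) := by
    intro u v h
    simpa using h
  rw [jacobiSum, ← (Finite.injective_iff_bijective.mp hinj).sum_comp, jacobiSum, Finset.mul_sum]
  refine Finset.sum_congr rfl fun u _ => ?_
  rcases eq_or_ne u 1 with rfl | hu
  · simp [MulChar.map_zero]
  have hu' : 1 - u ≠ 0 := sub_ne_zero.mpr hu.symm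
  have h1 : (1 : F) + (u - 1)⁻¹ = (-1) * (u * (1 - u)⁻¹) := by
    rw [← neg_sub 1 u]; field_simp; ring
  have h2 : (1 : F) - (1 + (u - 1)⁻¹) = (1 - u)⁻¹ := by
    rw [← neg_sub 1 u, inv_neg]; ring
  rw [h2, h1]
  simp only [map_mul, MulChar.inv_apply', MulChar.mul_apply]
  ring

lemma exists_sq_add_self_add_one_eq_zero {F : Type*} [Field F] [Fintype F]
    (hq : 3 ∣ Fintype.card F - 1) : ∃ ω : F, ω ≠ 1 ∧ ω ^ 2 + ω + 1 = 0 := by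
  classical
  have : Fact (Nat.Prime 3) := ⟨Nat.prime_three⟩
  obtain ⟨x, hx⟩ := exists_prime_orderOf_dvd_card (G := Fˣ) 3 (by rwa [Fintype.card_units])
  have h1 : (x : F) ^ 3 = 1 := by
    rw [← Units.val_pow_eq_pow_val, ← hx, pow_orderOf_eq_one, Units.val_one]
  have h2 : (x : F) ≠ 1 := by
    intro h
    have : x = 1 := Units.ext (by simpa using h)
    simp [this] at hx
  refine ⟨x, h2, mul_left_cancel₀ (sub_ne_zero.mpr h2) ?_⟩
  linear_combination h1

lemma exists_generator_apply_isPrimitiveRoot {F : Type*} [Field F] [Fintype F]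
    {η : MulChar F ℂ} (hη : orderOf η = 3) :
    ∃ g : Fˣ, (∀ x, x ∈ Subgroup.zpowers g) ∧ IsPrimitiveRoot (η g) 3 := by
  obtain ⟨g, hg⟩ := IsCyclic.exists_generator (α := Fˣ)
  refine ⟨g, hg, ?_⟩
  have : Fact (Nat.Prime 3) := ⟨Nat.prime_three⟩
  have h3 : η ^ 3 = 1 := by rw [← hη, pow_orderOf_eq_one]
  have h1 : η g ^ 3 = 1 := by rw [← MulChar.pow_apply_coe, h3, MulChar.one_apply_coe]
  have h2 : η g ≠ 1 := by
    intro h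
    have : η = 1 := (MulChar.eq_iff hg η 1).mpr (by rw [h, MulChar.one_apply_coe])
    simp [this] at hη
  have := IsPrimitiveRoot.orderOf (η g)
  rwa [orderOf_eq_prime h1 h2] at this

lemma cubic_apply_pow_three {F : Type*} [Field F] [Fintype F]
    {η : MulChar F ℂ} (hη : orderOf η = 3) {w : F} (hw : w ≠ 0) : η w ^ 3 = 1 := by
  have h3 : η ^ 3 = 1 := by rw [← hη, pow_orderOf_eq_one]
  rw [← MulChar.pow_apply' η three_ne_zero, h3, MulChar.one_apply hw.isUnit]

lemma exists_pow_three_eq_of_cubic_apply_eq_one {F : Type*} [Field F] [Fintype F]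
    {η : MulChar F ℂ} (hη : orderOf η = 3) {w : F} (hw : w ≠ 0) (h : η w = 1) :
    ∃ z : F, z ^ 3 = w := by
  obtain ⟨g, hg, hprim⟩ := exists_generator_apply_isPrimitiveRoot hη
  obtain ⟨k, hk⟩ := mem_powers_iff_mem_zpowers.mpr (hg (Units.mk0 w hw))
  have hw' : (g : F) ^ k = w := by
    simpa using congrArg Units.val hk
  rw [← hw', map_pow] at h
  obtain ⟨m, rfl⟩ := hprim.dvd_of_pow_eq_one k h
  exact ⟨(g : F) ^ m, by rw [← pow_mul, mul_comm, hw']⟩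

lemma card_pow_three_eq {F : Type*} [Field F] [Fintype F] [DecidableEq F]
    {η : MulChar F ℂ} (hη : orderOf η = 3) {ω : F} (hω1 : ω ≠ 1) (hω : ω ^ 2 + ω + 1 = 0)
    {w : F} (hw : w ≠ 0) :
    ((Finset.univ.filter fun z : F => z ^ 3 = w).card : ℂ) = 1 + η w + η⁻¹ w := by
  have h3 := cubic_apply_pow_three hη hw
  have hw0 : η w ≠ 0 := fun h => by simp [h] at h3
  by_cases h1 : η w = 1
  · obtain ⟨z, rfl⟩ := exists_pow_three_eq_of_cubic_apply_eq_one hη hw h1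
    have hz : z ≠ 0 := fun h => hw (by simp [h])
    have hω3 : ω ^ 3 = 1 := by linear_combination (ω - 1) * hω
    have hω0 : ω ≠ 0 := fun h => by simp [h] at hω
    have hfil : (Finset.univ.filter fun y : F => y ^ 3 = z ^ 3) = {z, z * ω, z * ω ^ 2} := by
      ext y
      simp only [Finset.mem_filter, Finset.mem_univ, true_and, Finset.mem_insert,
        Finset.mem_singleton]
      constructor
      · intro hy
        have : (y - z) * ((y - z * ω) * (y - z * ω ^ 2)) = 0 := by
          linear_combination hy + (y * z ^ 2 * ω - y ^ 2 * z) * hω +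
            (y * z ^ 2 - z ^ 3) * hω3 - y * z ^ 2 * (ω - 1) * hω
        rcases mul_eq_zero.mp this with h | h
        · exact Or.inl (sub_eq_zero.mp h)
        rcases mul_eq_zero.mp h with h | h
        · exact Or.inr (Or.inl (sub_eq_zero.mp h))
        · exact Or.inr (Or.inr (sub_eq_zero.mp h))
      · rintro (rfl | rfl | rfl)
        · rfl
        · linear_combination z ^ 3 * hω3
        · linear_combination z ^ 3 * (ω ^ 3 + 1) * hω3
    have hω2 : ω ^ 2 ≠ 1 := fun h => hω1 (by linear_combination hω3 - ω * h)
    have hcard : ({z, z * ω, z * ω ^ 2} : Finset F).card = 3 := by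
      rw [Finset.card_eq_three]
      refine ⟨z, z * ω, z * ω ^ 2, ?_, ?_, ?_, rfl⟩
      · simpa [hz] using hω1
      · simpa [hz] using hω2
      · intro h
        have := mul_left_cancel₀ hz h
        exact hω1 (mul_left_cancel₀ hω0 (by rw [← sq, ← this, mul_one]))
    rw [hfil, hcard, MulChar.inv_apply_eq_inv', h1]
    norm_num
  · have hfil : (Finset.univ.filter fun z : F => z ^ 3 = w) = ∅ := by
      refine Finset.filter_eq_empty_iff.mpr fun z _ hz => h1 ?_
      have hz0 : z ≠ 0 := fun h => hw (by simp [← hz, h])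
      rw [← hz, map_pow, cubic_apply_pow_three hη hz0]
    rw [hfil, MulChar.inv_apply_eq_inv', Finset.card_empty, Nat.cast_zero]
    have hs : 1 + η w + η w ^ 2 = 0 := mul_left_cancel₀ (sub_ne_zero.mpr h1) <| by
      linear_combination h3
    field_simp
    linear_combination -hs

lemma sum_comp_pow_three {F : Type*} [Field F] [Fintype F]
    {η : MulChar F ℂ} (hη : orderOf η = 3) {ω : F} (hω1 : ω ≠ 1) (hω : ω ^ 2 + ω + 1 = 0)
    (h : F → ℂ) (h0 : h 0 = 0) :
    ∑ z : F, h (z ^ 3) = ∑ w : F, h w * (1 + η w + η⁻¹ w) := by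
  classical
  rw [← Finset.sum_fiberwise _ (fun z : F => z ^ 3)]
  refine Finset.sum_congr rfl fun w _ => ?_
  rw [Finset.sum_congr rfl (g := fun _ => h w)
    (fun z hz => by rw [(Finset.mem_filter.mp hz).2]), Finset.sum_const, nsmul_eq_mul, mul_comm]
  rcases eq_or_ne w 0 with rfl | hw
  · simp [h0]
  · rw [card_pow_three_eq hη hω1 hω hw]

/-- A character is determined by its value at a generator `g`, and `η g` is a primitive cube root of
unity, so every character of order dividing 3 is a power of `η`. -/
lemma sum_cubeFiber {F : Type*} [Field F] [Fintype F]
    {η : MulChar F ℂ} (hη : orderOf η = 3) (A : MulChar F ℂ) (f : MulChar F ℂ → ℂ) :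
    ∑ B ∈ cubeFiber A, f B = f A + f (A * η) + f (A * η⁻¹) := by
  classical
  obtain ⟨g, hg, hprim⟩ := exists_generator_apply_isPrimitiveRoot hη
  have h3 : η ^ 3 = 1 := by rw [← hη, pow_orderOf_eq_one]
  have hinv : η⁻¹ = η ^ 2 := inv_eq_of_mul_eq_one_right (by rw [← h3]; group)
  have h1 : η ≠ 1 := fun h => by simp [h] at hη
  have h2 : η ^ 2 ≠ 1 := by
    rw [← hinv]; simpa using h1
  have hfib : cubeFiber A = {A, A * η, A * η⁻¹} := by
    ext B
    simp only [cubeFiber, Set.Finite.mem_toFinset, Set.mem_ofPred_eq, Finset.mem_insert,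
      Finset.mem_singleton]
    constructor
    · intro hB
      have hψ : (A⁻¹ * B) ^ 3 = 1 := by rw [mul_pow, inv_pow, hB, inv_mul_cancel]
      have hψg : (A⁻¹ * B) g ^ 3 = 1 := by
        rw [← MulChar.pow_apply_coe, hψ, MulChar.one_apply_coe]
      obtain ⟨i, hi, hig⟩ := hprim.eq_pow_of_pow_eq_one hψg
      rw [← MulChar.pow_apply_coe, ← MulChar.eq_iff hg] at hig
      have hB' : B = A * η ^ i := by rw [hig, mul_inv_cancel_left]
      interval_cases i
      · exact Or.inl (by simpa using hB')
      · exact Or.inr (Or.inl (by simpa using hB'))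
      · exact Or.inr (Or.inr (by rw [hinv]; exact hB'))
    · rintro (rfl | rfl | rfl)
      · rfl
      · rw [mul_pow, h3, mul_one]
      · rw [mul_pow, inv_pow, h3, inv_one, mul_one]
  rw [hfib, Finset.sum_insert, Finset.sum_insert, Finset.sum_singleton, add_assoc]
  · rw [Finset.mem_singleton, hinv, mul_right_inj, sq]
    simpa using h1
  · simp only [Finset.mem_insert, Finset.mem_singleton, left_eq_mul, inv_eq_one]
    simpa using h1

lemma cubeFiber_apply_neg_one {F : Type*} [Field F] [Fintype F] {A B : MulChar F ℂ}
    (hB : B ∈ cubeFiber A) : B (-1) = A (-1) := by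
  have h : B ^ 3 = A ^ 3 := by simpa [cubeFiber] using hB
  have key : ∀ C : MulChar F ℂ, (C ^ 3) (-1) = C (-1) := fun C => by
    rw [MulChar.pow_apply' C three_ne_zero, ← map_pow]; norm_num
  rw [← key B, h, key A]

/-! ### Termwise comparison by Gauss sums -/

/-- In Gauss sums, `g(Bχη)` and `g(B⁻¹χη⁻¹)` cancel on the left and `g(χ²)` on the right. What
remains differs by `g(η)g(η⁻¹) / (g(B)g(B⁻¹))`, which is a sign because `g(C)g(C⁻¹) = C(-1)q`. -/
lemma jacobiSum_ratio_eq {F : Type*} [Field F] [Fintype F] {B χ η : MulChar F ℂ}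
    (hη : η ≠ 1) (hB : B ≠ 1) (hχη : χ * η ≠ 1) (hχη' : χ * η⁻¹ ≠ 1) (hχ : χ ^ 2 ≠ 1)
    (h1 : B * χ * η ≠ 1) (h2 : B⁻¹ * χ * η⁻¹ ≠ 1) :
    (jacobiSum (B * χ) η * jacobiSum (B⁻¹ * χ) η⁻¹) /
        (jacobiSum B (χ * η) * jacobiSum B⁻¹ (χ * η⁻¹)) =
      B (-1) * (jacobiSum (B * χ) (B⁻¹ * χ) / (η (-1) * jacobiSum (η * χ) (χ * η⁻¹))) := by
  have hq : (Fintype.card F : ℂ) ≠ 0 := Nat.cast_ne_zero.mpr Fintype.card_ne_zero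
  have hψ := AddChar.FiniteField.primitiveChar_to_Complex_isPrimitive F
  set ψ := AddChar.FiniteField.primitiveChar_to_Complex F
  have hg : ∀ C : MulChar F ℂ, C ≠ 1 →
      gaussSum C ψ * gaussSum C⁻¹ ψ = C (-1) * Fintype.card F := fun C hC => by
    rw [← gaussSum_mul_gaussSum_eq_card hC hψ, ← mul_gaussSum_inv_eq_gaussSum C⁻¹ ψ,
      MulChar.inv_apply', inv_neg_one]
    ring
  have hne : ∀ C : MulChar F ℂ, C ≠ 1 → gaussSum C ψ ≠ 0 := fun C hC =>
    gaussSum_ne_zero_of_nontrivial hq hC hψ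
  have hJ : ∀ C D : MulChar F ℂ, C * D ≠ 1 →
      jacobiSum C D = gaussSum C ψ * gaussSum D ψ / gaussSum (C * D) ψ := fun C D h =>
    jacobiSum_eq_gaussSum_mul_gaussSum_div_gaussSum hq h hψ
  have e1 : B * (χ * η) = B * χ * η := by group
  have e2 : B⁻¹ * (χ * η⁻¹) = B⁻¹ * χ * η⁻¹ := by group
  have e3 : B * χ * (B⁻¹ * χ) = χ ^ 2 := by
    rw [mul_mul_mul_comm, mul_inv_cancel, one_mul, sq]
  have e4 : η * χ * (χ * η⁻¹) = χ ^ 2 := by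
    rw [mul_comm η χ, mul_mul_mul_comm, mul_inv_cancel, mul_one, sq]
  rw [hJ _ _ h1, hJ _ _ h2, hJ B _ (e1 ▸ h1), hJ B⁻¹ _ (e2 ▸ h2), hJ _ _ (e3 ▸ hχ),
    hJ (η * χ) _ (e4 ▸ hχ), e1, e2, e3, e4, mul_comm η χ]
  have n1 := hne _ h1
  have n2 := hne _ h2
  have n3 := hne _ hχ
  have n4 := hne _ hχη
  have n5 := hne _ hχη'
  have n6 := hne _ hB
  have n7 := hne _ (inv_ne_one.mpr hB)
  have g1 := hg _ hη
  have g2 := hg _ hB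
  have hsq : ∀ C : MulChar F ℂ, C (-1) * C (-1) = 1 := fun C => by
    rw [← map_mul]; norm_num
  have hη0 : η (-1) ≠ 0 := left_ne_zero_of_mul_eq_one (hsq η)
  field_simp
  linear_combination η (-1) * gaussSum (B * χ) ψ * gaussSum (B⁻¹ * χ) ψ * g1
    - B (-1) * gaussSum (B * χ) ψ * gaussSum (B⁻¹ * χ) ψ * g2
    + gaussSum (B * χ) ψ * gaussSum (B⁻¹ * χ) ψ * Fintype.card F * (hsq η - hsq B)

/-! ### Fibres of `m²` and `z + z⁻¹` -/

lemma quadCharC_apply {F : Type*} [Field F] [Fintype F] [DecidableEq F] (a : F) :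
    quadCharC F a = (quadraticChar F a : ℂ) := rfl

lemma card_sq_eq {F : Type*} [Field F] [Fintype F] [DecidableEq F] (hF : ringChar F ≠ 2) (a : F) :
    ((Finset.univ.filter fun x : F => x ^ 2 = a).card : ℂ) = 1 + quadCharC F a := by
  have h := quadraticChar_card_sqrts hF a
  have h' : {x : F | x ^ 2 = a}.toFinset = Finset.univ.filter fun x : F => x ^ 2 = a := by
    ext; simp
  rw [h'] at h
  rw [quadCharC_apply, add_comm]
  exact_mod_cast h

lemma sum_comp_sq {F : Type*} [Field F] [Fintype F] [DecidableEq F] (hF : ringChar F ≠ 2)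
    (h : F → ℂ) : ∑ m : F, h (m ^ 2) = ∑ n : F, h n * (1 + quadCharC F n) := by
  rw [← Finset.sum_fiberwise _ (fun z : F => z ^ 2)]
  refine Finset.sum_congr rfl fun w _ => ?_
  rw [Finset.sum_congr rfl (g := fun _ => h w)
    (fun z hz => by rw [(Finset.mem_filter.mp hz).2]), Finset.sum_const, nsmul_eq_mul, mul_comm,
    card_sq_eq hF]

lemma card_add_inv_eq {F : Type*} [Field F] [Fintype F] [DecidableEq F] (hF : ringChar F ≠ 2)
    (v : F) : ((Finset.univ.filter fun z : F => z ≠ 0 ∧ z + z⁻¹ = v).card : ℂ) =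
      1 + quadCharC F (v ^ 2 - 4) := by
  have h2 : (2 : F) ≠ 0 := Ring.two_ne_zero hF
  rw [← card_sq_eq hF]
  congr 1
  -- Completing the square in `z² - vz + 1 = 0`.
  refine Finset.card_nbij' (fun z => 2 * z - v) (fun s => (s + v) / 2) ?_ ?_ ?_ ?_
  · intro z hz
    obtain ⟨hz0, hz⟩ : z ≠ 0 ∧ z + z⁻¹ = v := by simpa using hz
    simp only [Finset.coe_filter, Finset.mem_univ, true_and, Set.mem_ofPred_eq]
    have : z * z + 1 = v * z := by rw [← hz]; field_simp
    linear_combination 4 * this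
  · intro s hs
    have hs : s ^ 2 = v ^ 2 - 4 := by simpa using hs
    simp only [Finset.coe_filter, Finset.mem_univ, true_and, Set.mem_ofPred_eq]
    have hne : (s + v) ≠ 0 := by
      intro h
      have : (2 : F) * 2 = 0 := by linear_combination (v - s) * h + hs
      exact h2 (by simpa using this)
    refine ⟨div_ne_zero hne h2, ?_⟩
    field_simp
    linear_combination hs
  · intro z _
    simp only
    field_simp
    ring
  · intro s _
    simp only
    field_simp
    ring

lemma sum_comp_add_inv {F : Type*} [Field F] [Fintype F] [DecidableEq F] (hF : ringChar F ≠ 2)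
    (h : F → ℂ) : ∑ z ∈ Finset.univ.filter (fun z : F => z ≠ 0), h (z + z⁻¹) =
      ∑ v : F, h v * (1 + quadCharC F (v ^ 2 - 4)) := by
  rw [← Finset.sum_fiberwise _ (fun z : F => z + z⁻¹)]
  refine Finset.sum_congr rfl fun w _ => ?_
  rw [Finset.sum_congr rfl (g := fun _ => h w)
    (fun z hz => by rw [(Finset.mem_filter.mp hz).2]), Finset.sum_const, nsmul_eq_mul, mul_comm,
    Finset.filter_filter, card_add_inv_eq hF]

/-! ### The Dickson cubic `v³ - 3v` and cubic Hasse–Davenport -/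

/-- The cubic permutes the `v` for which `z + z⁻¹ = v` has no root in `F`. Conceptually, such `z`
lie in the norm-one group of the quadratic extension, of order `q + 1` prime to 3, and the cubic is
`z ↦ z³`. The proof stays in `F`, using that `-3 = (2ω + 1)²` is a square. -/
lemma sum_nonsplit_comp_cubic {F : Type*} [Field F] [Fintype F]
    {ω : F} (hω : ω ^ 2 + ω + 1 = 0) (h3 : (3 : F) ≠ 0)
    [DecidablePred fun v : F => ¬ IsSquare (v ^ 2 - 4)] (g : F → ℂ) :
    ∑ v ∈ Finset.univ.filter (fun v : F => ¬ IsSquare (v ^ 2 - 4)), g (v ^ 3 - 3 * v) =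
      ∑ v ∈ Finset.univ.filter (fun v : F => ¬ IsSquare (v ^ 2 - 4)), g v := by
  classical
  set N := Finset.univ.filter (fun v : F => ¬ IsSquare (v ^ 2 - 4)) with hN
  have hm : ∀ v, v ∈ N ↔ ¬ IsSquare (v ^ 2 - 4) := fun v => by simp [hN]
  have hsq3 : (2 * ω + 1) ^ 2 = -3 := by linear_combination 4 * hω
  have hω0 : 2 * ω + 1 ≠ 0 := fun h => h3 (by linear_combination hsq3 - (2 * ω + 1) * h)
  have hinj : Set.InjOn (fun v : F => v ^ 3 - 3 * v) N := by
    intro u _ v hv huv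
    by_contra hne
    have hq : u ^ 2 + u * v + v ^ 2 = 3 :=
      mul_left_cancel₀ (sub_ne_zero.mpr hne) (by linear_combination huv)
    -- From `u² + uv + v² = 3` follows `(2u + v)² = -3(v² - 4)`.
    refine (hm v).mp hv ⟨(2 * u + v) / (2 * ω + 1), ?_⟩
    field_simp
    linear_combination (v ^ 2 - 4) * hsq3 - 4 * hq
  have hmaps : N.image (fun v : F => v ^ 3 - 3 * v) ⊆ N := by
    intro t ht
    obtain ⟨v, hv, rfl⟩ := Finset.mem_image.mp ht
    rw [hm] at hv ⊢
    rintro ⟨r, hr⟩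
    have hv1 : v ^ 2 - 1 ≠ 0 := fun h => hv ⟨2 * ω + 1, by linear_combination h - hsq3⟩
    -- `(v³ - 3v)² - 4 = (v² - 4)(v² - 1)²`.
    refine hv ⟨r / (v ^ 2 - 1), ?_⟩
    field_simp
    linear_combination hr
  have himg : N.image (fun v : F => v ^ 3 - 3 * v) = N :=
    Finset.eq_of_subset_of_card_le hmaps (Finset.card_image_of_injOn hinj).ge
  conv_rhs => rw [← himg]
  rw [Finset.sum_image hinj]

lemma sum_comp_cubic_mul_one_sub {F : Type*} [Field F] [Fintype F] [DecidableEq F]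
    {ω : F} (hω : ω ^ 2 + ω + 1 = 0) (h3 : (3 : F) ≠ 0) (g : F → ℂ) :
    ∑ v : F, g (v ^ 3 - 3 * v) * (1 - quadCharC F (v ^ 2 - 4)) =
      ∑ v : F, g v * (1 - quadCharC F (v ^ 2 - 4)) := by
  classical
  -- The weight is supported on the nonsplit `v` and on `v = ±2`; the latter are fixed points of the
  -- cubic.
  have key : ∀ v : F, 1 - quadCharC F (v ^ 2 - 4) =
      (if ¬ IsSquare (v ^ 2 - 4) then 2 else 0) + (if v ^ 2 = 4 then 1 else 0) := by
    intro v
    rw [quadCharC_apply]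
    by_cases h0 : v ^ 2 = 4
    · simp [h0]
    have h0' : v ^ 2 - 4 ≠ 0 := sub_ne_zero.mpr h0
    by_cases hs : IsSquare (v ^ 2 - 4)
    · rw [(quadraticChar_one_iff_isSquare h0').mpr hs]; simp [h0, hs]
    · rw [quadraticChar_neg_one_iff_not_isSquare.mpr hs]; simp [h0, hs]; norm_num
  simp_rw [key, mul_add, Finset.sum_add_distrib, mul_ite, mul_zero, ← Finset.sum_filter]
  rw [sum_nonsplit_comp_cubic hω h3 (fun v => g v * 2)]
  congr 1
  refine Finset.sum_congr rfl fun v hv => ?_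
  have hv : v ^ 2 = 4 := by simpa using hv
  have : v ^ 3 - 3 * v = v := by linear_combination v * hv
  rw [this]

/-- Average of two weighted identities. With weight `1 - φ(v² - 4)` the cubic acts as a permutation;
with weight `1 + φ(v² - 4)` one writes `v = z + z⁻¹`, the cubic becomes `z ↦ z³`, and `1 + η + η⁻¹`
counts cube roots. -/
lemma sum_comp_cubic {F : Type*} [Field F] [Fintype F] (hF : ringChar F ≠ 2)
    (h3 : (3 : F) ≠ 0) {η : MulChar F ℂ} (hη : orderOf η = 3)
    {ω : F} (hω1 : ω ≠ 1) (hω : ω ^ 2 + ω + 1 = 0) (g : F → ℂ) :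
    ∑ v : F, g (v ^ 3 - 3 * v) = ∑ v : F, g v + ∑ w : F, g (w + w⁻¹) * η w := by
  classical
  have e1 := sum_comp_cubic_mul_one_sub hω h3 g
  have e2 := sum_comp_add_inv hF (fun v => g (v ^ 3 - 3 * v))
  have e3 := sum_comp_add_inv hF g
  -- The cutoff removes the spurious value of `w + w⁻¹` at `w = 0`.
  have e4 := sum_comp_pow_three hη hω1 hω (fun w => if w ≠ 0 then g (w + w⁻¹) else 0) (by simp)
  have e5 : ∑ w : F, g (w + w⁻¹) * η⁻¹ w = ∑ w : F, g (w + w⁻¹) * η w := by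
    rw [← (inv_involutive (G := F)).bijective.sum_comp]
    refine Finset.sum_congr rfl fun w _ => ?_
    rw [MulChar.inv_apply', inv_inv, add_comm]
  have e6 : ∑ z : F, (if z ^ 3 ≠ 0 then g (z ^ 3 + (z ^ 3)⁻¹) else 0) =
      ∑ z ∈ Finset.univ.filter (fun z : F => z ≠ 0),
        g ((z + z⁻¹) ^ 3 - 3 * (z + z⁻¹)) := by
    rw [Finset.sum_filter]
    refine Finset.sum_congr rfl fun z _ => ?_
    rcases eq_or_ne z 0 with rfl | hz
    · simp
    rw [if_pos (pow_ne_zero 3 hz), if_pos hz]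
    congr 1
    field_simp
    ring
  have e7 : ∑ w : F, (if w ≠ 0 then g (w + w⁻¹) else 0) * (1 + η w + η⁻¹ w) =
      ∑ z ∈ Finset.univ.filter (fun z : F => z ≠ 0), g (z + z⁻¹) +
        ∑ w : F, g (w + w⁻¹) * η w + ∑ w : F, g (w + w⁻¹) * η⁻¹ w := by
    rw [Finset.sum_filter, ← Finset.sum_add_distrib, ← Finset.sum_add_distrib]
    refine Finset.sum_congr rfl fun w _ => ?_
    rcases eq_or_ne w 0 with rfl | hw
    · simp [MulChar.map_zero]
    rw [if_pos hw]
    ring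
  rw [e6, e2] at e4
  rw [← e4] at e7
  simp only [mul_add, mul_sub, mul_one, Finset.sum_add_distrib, Finset.sum_sub_distrib]
    at e1 e3 e7
  linear_combination (1 / 2 : ℂ) * (e1 + e7 + e5 + e3)

/-- The cubic Hasse–Davenport product formula, in terms of Jacobi sums. -/
lemma jacobiSum_triplication {F : Type*} [Field F] [Fintype F] (hF : ringChar F ≠ 2)
    (h3 : (3 : F) ≠ 0) {η : MulChar F ℂ} (hη : orderOf η = 3)
    {ω : F} (hω1 : ω ≠ 1) (hω : ω ^ 2 + ω + 1 = 0) {χ : MulChar F ℂ} (hχ : χ ≠ 1) :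
    jacobiSum χ⁻¹ (χ⁻¹ ^ 2) = χ 27 * jacobiSum (η * χ) (χ * η⁻¹) := by
  have key := sum_comp_cubic hF h3 hη hω1 hω (fun v => χ⁻¹ (2 - v))
  have s0 : ∑ v : F, χ⁻¹ (2 - v) = 0 := by
    rw [← MulChar.sum_eq_zero_of_ne_one (inv_ne_one.mpr hχ),
      ← (Equiv.subLeft (2 : F)).sum_comp (fun v => χ⁻¹ v)]
    rfl
  have hη1 : η (-1) = 1 := by
    refine MulChar.val_neg_one_eq_one_of_odd_order (n := 3) (by decide) ?_
    rw [← hη, pow_orderOf_eq_one]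
  -- Since `2 + 3v - v³ = (2 - v)(v + 1)²`, setting `v = 2 - 3y` gives `27 y (1 - y)²`.
  have s1 : ∑ v : F, χ⁻¹ (2 - (v ^ 3 - 3 * v)) = χ⁻¹ 27 * jacobiSum χ⁻¹ (χ⁻¹ ^ 2) := by
    have hb : Function.Bijective (fun y : F => 2 - 3 * y) :=
      Finite.injective_iff_bijective.mp fun a b h => by simpa [h3] using h
    rw [← hb.sum_comp, jacobiSum, Finset.mul_sum]
    refine Finset.sum_congr rfl fun y _ => ?_
    rw [MulChar.pow_apply' _ two_ne_zero, ← map_pow, ← map_mul, ← map_mul]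
    congr 1
    ring
  have s2 : ∑ w : F, χ⁻¹ (2 - (w + w⁻¹)) * η w = jacobiSum (η * χ) (χ * η⁻¹) := by
    rw [jacobiSum_eq_apply_neg_one_mul]
    have e : (η * χ * (χ * η⁻¹))⁻¹ = χ⁻¹ ^ 2 := by
      rw [mul_comm η χ, mul_mul_mul_comm, mul_inv_cancel, mul_one, sq, mul_inv]
    rw [e, MulChar.mul_apply, hη1, one_mul, jacobiSum, Finset.mul_sum]
    refine Finset.sum_congr rfl fun w _ => ?_
    rcases eq_or_ne w 0 with rfl | hw
    · simp [MulChar.map_zero]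
    rw [MulChar.pow_apply' _ two_ne_zero, ← map_pow, MulChar.mul_apply,
      show 2 - (w + w⁻¹) = (-1 * w)⁻¹ * (1 - w) ^ 2 by field_simp; ring, map_mul χ⁻¹,
      MulChar.inv_apply' χ (-1 * w)⁻¹, inv_inv, map_mul χ]
    ring
  rw [s0, s1, s2, zero_add] at key
  have h27 : χ 27 * χ⁻¹ 27 = 1 := by
    have : (27 : F) ≠ 0 := by
      have := pow_ne_zero 3 h3
      norm_num at this; exact this
    rw [MulChar.inv_apply', ← map_mul, mul_inv_cancel₀ this, map_one]
  rw [← key, ← mul_assoc, h27, one_mul]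

/-! ### Evaluation of the `₂ℙ₁` sum -/

lemma quadCharC_mul_self {F : Type*} [Field F] [Fintype F] [DecidableEq F] {a : F} (ha : a ≠ 0) :
    quadCharC F a * quadCharC F a = 1 := by
  rw [quadCharC_apply, ← Int.cast_mul, ← sq, quadraticChar_sq_one ha, Int.cast_one]

lemma quadCharC_inv {F : Type*} [Field F] [Fintype F] [DecidableEq F] (a : F) :
    quadCharC F a⁻¹ = quadCharC F a := by
  rcases eq_or_ne a 0 with rfl | ha
  · simp
  have h := quadCharC_mul_self ha
  have h' : quadCharC F a * quadCharC F a⁻¹ = 1 := by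
    rw [← map_mul, mul_inv_cancel₀ ha, map_one]
  exact mul_left_cancel₀ (left_ne_zero_of_mul_eq_one h) (h'.trans h.symm)

/-- The `₂ℙ₁` character sum with parameters `C, C⁻¹; φ`, in the variable `x = 1 - y`. -/
lemma sum_period_eq_sum_one_sub {F : Type*} [Field F] [Fintype F] (φ C : MulChar F ℂ) (lam : F) :
    ∑ y : F, C⁻¹ y * (C * φ) (1 - y) * C⁻¹ (1 - lam * y) =
      ∑ x : F, φ x * C (x * (1 - x)⁻¹ * (1 - lam + lam * x)⁻¹) := by
  rw [← (Equiv.subLeft (1 : F)).sum_comp]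
  refine Finset.sum_congr rfl fun x _ => ?_
  simp only [Equiv.subLeft_apply, MulChar.mul_apply, MulChar.inv_apply', sub_sub_cancel, map_mul]
  rw [show 1 - lam * (1 - x) = 1 - lam + lam * x by ring]
  ring

/-- The involution `x ↦ c/x` with `c = -(1 - λ)/λ` preserves the argument of `C`, and it flips the
sign of `φ(x)` because `c` is a nonsquare. -/
lemma sum_period_eq_zero {F : Type*} [Field F] [Fintype F] [DecidableEq F] (C : MulChar F ℂ)
    {lam : F} (h : ¬ IsSquare (-(lam * (1 - lam)))) :
    ∑ x : F, quadCharC F x * C (x * (1 - x)⁻¹ * (1 - lam + lam * x)⁻¹) = 0 := by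
  have h0 : lam ≠ 0 := fun h0 => h ⟨0, by simp [h0]⟩
  have h1 : 1 - lam ≠ 0 := fun h1 => h ⟨0, by simp [h1]⟩
  set c := -(1 - lam) / lam with hc
  have hc0 : c ≠ 0 := div_ne_zero (neg_ne_zero.mpr h1) h0
  have hφc : quadCharC F c = -1 := by
    rw [quadCharC_apply, quadraticChar_neg_one_iff_not_isSquare.mpr, Int.cast_neg, Int.cast_one]
    rintro ⟨r, hr⟩
    refine h ⟨lam * r, ?_⟩
    rw [hc, div_eq_iff h0] at hr
    linear_combination lam * hr
  have hb : Function.Bijective (fun x : F => c * x⁻¹) :=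
    Finite.injective_iff_bijective.mp fun a b h => by simpa [hc0] using h
  have key : ∑ x : F, quadCharC F x * C (x * (1 - x)⁻¹ * (1 - lam + lam * x)⁻¹) =
      -∑ x : F, quadCharC F x * C (x * (1 - x)⁻¹ * (1 - lam + lam * x)⁻¹) := by
    conv_lhs => rw [← hb.sum_comp]
    rw [← Finset.sum_neg_distrib]
    refine Finset.sum_congr rfl fun x _ => ?_
    rcases eq_or_ne x 0 with rfl | hx
    · simp [MulChar.map_zero]
    rw [map_mul, hφc, quadCharC_inv]
    have e1 : 1 - c * x⁻¹ = (1 - lam + lam * x) * (lam * x)⁻¹ := by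
      rw [hc]; field_simp; ring
    have e2 : 1 - lam + lam * (c * x⁻¹) = -(1 - lam) * (1 - x) * x⁻¹ := by
      rw [hc]; field_simp; ring
    have e3 : c * x⁻¹ * (1 - c * x⁻¹)⁻¹ * (1 - lam + lam * (c * x⁻¹))⁻¹ =
        x * (1 - x)⁻¹ * (1 - lam + lam * x)⁻¹ := by
      rw [e1, e2, hc]
      simp only [mul_inv, inv_inv, inv_neg]
      field_simp
    rw [e3]
    ring
  exact self_eq_neg.mp key

lemma quadCharC_eq_inv {F : Type*} [Field F] [Fintype F] [DecidableEq F] :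
    (quadCharC F)⁻¹ = quadCharC F :=
  MulChar.ext' fun a => by rw [MulChar.inv_apply', quadCharC_inv]

lemma sum_period_one {F : Type*} [Field F] [Fintype F] [DecidableEq F] (C : MulChar F ℂ) :
    ∑ x : F, quadCharC F x * C (x * (1 - x)⁻¹ * (1 - 1 + 1 * x)⁻¹) =
      jacobiSum (quadCharC F * C) C⁻¹ * C (-1) := by
  have h : jacobiSum C⁻¹ (quadCharC F) = C (-1) * jacobiSum C⁻¹ (quadCharC F * C) := by
    rw [jacobiSum_eq_apply_neg_one_mul, mul_inv, inv_inv, quadCharC_eq_inv, mul_comm C,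
      MulChar.inv_apply', inv_neg_one]
  rw [jacobiSum_comm _ C⁻¹, mul_comm, ← h, jacobiSum_comm, jacobiSum]
  refine Finset.sum_congr rfl fun x _ => ?_
  rcases eq_or_ne x 0 with rfl | hx
  · simp [MulChar.map_zero]
  rw [MulChar.inv_apply']
  rw [show (1 : F) - 1 + 1 * x = x by ring]
  congr 2
  field_simp

lemma quadCharC_sq {F : Type*} [Field F] [Fintype F] [DecidableEq F] {a : F} (ha : a ≠ 0) :
    quadCharC F (a ^ 2) = 1 := by
  rw [sq, map_mul, quadCharC_mul_self ha]

lemma sum_quadCharC_mul_left {F : Type*} [Field F] [Fintype F] [DecidableEq F]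
    (C : MulChar F ℂ) {z : F} (hz : 1 - z ^ 2 ≠ 0) :
    ∑ n : F, quadCharC F (1 - n) * C (z * (1 - n) * (n - z ^ 2)⁻¹) =
      quadCharC F (1 - z ^ 2) * (C z * jacobiSum (quadCharC F * C) C⁻¹) := by
  have hb : Function.Bijective (fun j : F => 1 - (1 - z ^ 2) * j) :=
    Finite.injective_iff_bijective.mp fun a b h => by simpa [hz] using h
  rw [← hb.sum_comp, jacobiSum, Finset.mul_sum, Finset.mul_sum]
  refine Finset.sum_congr rfl fun j _ => ?_
  rw [sub_sub_cancel, show 1 - (1 - z ^ 2) * j - z ^ 2 = (1 - z ^ 2) * (1 - j) by ring,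
    show z * ((1 - z ^ 2) * j) * ((1 - z ^ 2) * (1 - j))⁻¹ = z * j * (1 - j)⁻¹ by
      rw [mul_inv]; field_simp]
  simp only [map_mul, MulChar.mul_apply, MulChar.inv_apply']
  ring

lemma sum_quadCharC_mul_right {F : Type*} [Field F] [Fintype F] [DecidableEq F]
    (C : MulChar F ℂ) {z : F} (hz0 : z ≠ 0) (hz : 1 - z ^ 2 ≠ 0) :
    ∑ n : F, quadCharC F (1 - n) * C (z * (1 - n) * (n - z ^ 2)⁻¹) * quadCharC F n +
        quadCharC F (-1) * C (-z) =
      quadCharC F (1 - z ^ 2) * (C z⁻¹ * jacobiSum (quadCharC F * C) C⁻¹) := by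
  classical
  -- The Möbius map `n ↦ a(1 - 1/n)` takes `n = ∞` to `a`. As `0⁻¹ = 0`, the code's map takes this
  -- value at `n = 0`, where `φ(n)` kills the original term; the extra summand `φ(-1) C(-z)` is
  -- exactly the term at `a`.
  set a := -z ^ 2 * (1 - z ^ 2)⁻¹ with ha
  have ha0 : a ≠ 0 := mul_ne_zero (neg_ne_zero.mpr (pow_ne_zero 2 hz0)) (inv_ne_zero hz)
  have hb : Function.Bijective (fun n : F => a * (1 - n⁻¹)) :=
    Finite.injective_iff_bijective.mp fun a b h => by simpa [ha0] using h
  have hsum : quadCharC F (-1) * C (-z) =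
      ∑ n : F, if n = 0 then quadCharC F (-1) * C (-z) else 0 := by simp
  conv_rhs => rw [jacobiSum, ← hb.sum_comp, Finset.mul_sum, Finset.mul_sum]
  rw [hsum, ← Finset.sum_add_distrib]
  refine Finset.sum_congr rfl fun n _ => ?_
  have hφ : quadCharC F a = quadCharC F (-1) * quadCharC F (1 - z ^ 2) := by
    rw [ha, map_mul, quadCharC_inv, ← neg_one_mul (z ^ 2), map_mul, quadCharC_sq hz0, mul_one]
  have hφz := quadCharC_mul_self hz
  rw [MulChar.mul_apply, MulChar.inv_apply', map_mul (quadCharC F), hφ]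
  rcases eq_or_ne n 0 with rfl | hn
  · have e : -z = z⁻¹ * (a * (1 - a)⁻¹) := by
      have : 1 - a = (1 - z ^ 2)⁻¹ := by rw [ha]; field_simp; ring
      rw [this, inv_inv, ha]
      field_simp
    simp only [if_true, MulChar.map_zero, mul_zero, zero_add, inv_zero, sub_zero, mul_one, map_one]
    rw [e, map_mul C, map_mul C]
    linear_combination -quadCharC F (-1) * C z⁻¹ * C a * C (1 - a)⁻¹ * hφz
  · have e1 : 1 - n⁻¹ = -1 * (1 - n) * n⁻¹ := by field_simp; ring
    have e2 : 1 - a * (1 - n⁻¹) = (n - z ^ 2) * (1 - z ^ 2)⁻¹ * n⁻¹ := by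
      rw [ha]; field_simp; ring
    have e3 : z * (1 - n) * (n - z ^ 2)⁻¹ =
        z⁻¹ * ((a * (1 - n⁻¹)) * (1 - a * (1 - n⁻¹))⁻¹) := by
      rw [e2, e1, ha]
      simp only [mul_inv, inv_inv]
      field_simp
    have hφ1 := quadCharC_mul_self (neg_ne_zero.mpr (one_ne_zero (α := F)))
    have e4 : quadCharC F (1 - n⁻¹) = quadCharC F (-1) * quadCharC F (1 - n) * quadCharC F n := by
      rw [e1, map_mul, map_mul, quadCharC_inv]
    rw [if_neg hn, e3, map_mul C, map_mul C _ (1 - a * (1 - n⁻¹))⁻¹, e4, add_zero]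
    linear_combination -quadCharC F (1 - n) * quadCharC F n * C z⁻¹ * C (a * (1 - n⁻¹)) *
      C (1 - a * (1 - n⁻¹))⁻¹ * (quadCharC F (1 - z ^ 2) * quadCharC F (1 - z ^ 2) * hφ1 + hφz)

/-- Here `-(1 - λ)/λ = r²` with `r = (1 + z)/(1 - z)`. The coordinate `x = r(1 + m)/(1 - m)` turns
the involution `x ↦ r²/x` into `m ↦ -m`, so the summand depends on `m²` only. Summing over `n = m²`
with weight `1 + φ(n)` yields the two terms `C z` and `C z⁻¹`. -/
lemma sum_period_split {F : Type*} [Field F] [Fintype F] [DecidableEq F] (hF : ringChar F ≠ 2)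
    (C : MulChar F ℂ) {z lam : F} (hz0 : z ≠ 0) (hz1 : z ≠ 1) (hz2 : z ≠ -1)
    (hlam : lam = -(1 - z) ^ 2 / (4 * z)) :
    ∑ x : F, quadCharC F x * C (x * (1 - x)⁻¹ * (1 - lam + lam * x)⁻¹) =
      jacobiSum (quadCharC F * C) C⁻¹ * (C z + C z⁻¹) := by
  have h2 : (2 : F) ≠ 0 := Ring.two_ne_zero hF
  have h4 : (4 : F) ≠ 0 := by rw [show (4 : F) = 2 * 2 by norm_num]; exact mul_ne_zero h2 h2
  have hm : 1 - z ≠ 0 := sub_ne_zero.mpr hz1.symm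
  have hp : 1 + z ≠ 0 := fun h => hz2 (by linear_combination h)
  have hz : 1 - z ^ 2 ≠ 0 := by
    rw [show 1 - z ^ 2 = (1 - z) * (1 + z) by ring]; exact mul_ne_zero hm hp
  have hφz := quadCharC_mul_self hz
  set r := (1 + z) * (1 - z)⁻¹ with hr
  have hr0 : r ≠ 0 := mul_ne_zero hp (inv_ne_zero hm)
  have hφr : quadCharC F r = quadCharC F (1 - z ^ 2) := by
    rw [hr, map_mul, quadCharC_inv, ← map_mul]; congr 1; ring
  -- `2/(1 - m) - 1 = (1 + m)/(1 - m)`; in this form `m = 1` is sent to `-r`, the value that belongs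
  -- to `m = ∞`, hence the separate term in `key`.
  have hb : Function.Bijective (fun m : F => r * (2 * (1 - m)⁻¹ - 1)) :=
    Finite.injective_iff_bijective.mp fun a b h => by simpa [hr0, h2] using h
  have key : ∀ m : F, quadCharC F (r * (2 * (1 - m)⁻¹ - 1)) *
      C (r * (2 * (1 - m)⁻¹ - 1) * (1 - r * (2 * (1 - m)⁻¹ - 1))⁻¹ *
        (1 - lam + lam * (r * (2 * (1 - m)⁻¹ - 1)))⁻¹) =
      quadCharC F (1 - z ^ 2) *
        (quadCharC F (1 - m ^ 2) * C (z * (1 - m ^ 2) * (m ^ 2 - z ^ 2)⁻¹) +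
          if m = 1 then quadCharC F (-1) * C (-z) else 0) := by
    intro m
    rcases eq_or_ne m 1 with rfl | hm1
    · have e0 : r * (2 * (1 - 1)⁻¹ - 1) = -1 * r := by simp
      have e1 : 1 - -1 * r = 2 * (1 - z)⁻¹ := by rw [hr]; field_simp; ring
      have e2 : 1 - lam + lam * (-1 * r) = (1 + z) * (2 * z)⁻¹ := by
        rw [hr, hlam]; field_simp; ring
      have e3 : -1 * r * (1 - -1 * r)⁻¹ * (1 - lam + lam * (-1 * r))⁻¹ = -z := by
        rw [e1, e2, hr]; field_simp
      rw [e0, e3, map_mul, hφr]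
      simp [MulChar.map_zero]
      ring
    · have hm1' : 1 - m ≠ 0 := sub_ne_zero.mpr hm1.symm
      have e0 : r * (2 * (1 - m)⁻¹ - 1) = r * ((1 + m) * (1 - m)⁻¹) := by
        congr 1; field_simp; ring
      have e1 : 1 - r * ((1 + m) * (1 - m)⁻¹) =
          -2 * (z + m) * (1 - z)⁻¹ * (1 - m)⁻¹ := by
        rw [hr]; field_simp; ring
      have e2 : 1 - lam + lam * (r * ((1 + m) * (1 - m)⁻¹)) =
          (1 + z) * (z - m) * (2 * z)⁻¹ * (1 - m)⁻¹ := by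
        rw [hr, hlam]; field_simp; ring
      have e3 : r * ((1 + m) * (1 - m)⁻¹) * (1 - r * ((1 + m) * (1 - m)⁻¹))⁻¹ *
          (1 - lam + lam * (r * ((1 + m) * (1 - m)⁻¹)))⁻¹ =
          z * (1 - m ^ 2) * (m ^ 2 - z ^ 2)⁻¹ := by
        rw [e1, e2, hr, show m ^ 2 - z ^ 2 = -1 * ((z + m) * (z - m)) by ring]
        simp only [mul_inv, inv_inv]
        field_simp
        ring
      have e4 : quadCharC F ((1 + m) * (1 - m)⁻¹) = quadCharC F (1 - m ^ 2) := by
        rw [map_mul, quadCharC_inv, ← map_mul]; congr 1; ring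
      rw [e0, e3, map_mul, hφr, e4, if_neg hm1]
      ring
  rw [← hb.sum_comp, Finset.sum_congr rfl fun m _ => key m, ← Finset.mul_sum,
    Finset.sum_add_distrib,
    sum_comp_sq hF fun n => quadCharC F (1 - n) * C (z * (1 - n) * (n - z ^ 2)⁻¹)]
  simp only [mul_add, mul_one, Finset.sum_add_distrib, Finset.sum_ite_eq', Finset.mem_univ,
    if_true]
  have i1 := sum_quadCharC_mul_right C hz0 hz
  have i2 := sum_quadCharC_mul_left C hz
  linear_combination quadCharC F (1 - z ^ 2) * (i1 + i2) +
    (C z + C z⁻¹) * jacobiSum (quadCharC F * C) C⁻¹ * hφz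

lemma sum_period_eq {F : Type*} [Field F] [Fintype F] [DecidableEq F] (hF : ringChar F ≠ 2)
    (C : MulChar F ℂ) {lam : F} (hlam : lam ≠ 0) :
    ∑ y : F, C⁻¹ y * (C * quadCharC F) (1 - y) * C⁻¹ (1 - lam * y) =
      jacobiSum (quadCharC F * C) C⁻¹ *
        ∑ z ∈ Finset.univ.filter (fun z : F => z ≠ 0 ∧ z + z⁻¹ = 2 - 4 * lam), C z := by
  have h2 : (2 : F) ≠ 0 := Ring.two_ne_zero hF
  have h4 : (4 : F) ≠ 0 := by rw [show (4 : F) = 2 * 2 by norm_num]; exact mul_ne_zero h2 h2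
  rw [sum_period_eq_sum_one_sub]
  rcases eq_or_ne lam 1 with rfl | hlam1
  · rw [sum_period_one]
    congr 1
    have : (Finset.univ.filter fun z : F => z ≠ 0 ∧ z + z⁻¹ = 2 - 4 * 1) = {-1} := by
      ext z
      simp only [Finset.mem_filter, Finset.mem_univ, true_and, Finset.mem_singleton]
      constructor
      · rintro ⟨hz, h⟩
        have : (z + 1) ^ 2 = 0 := by
          have h' : z * z + 1 = (2 - 4 * 1) * z := by rw [← h]; field_simp
          linear_combination h'
        linear_combination pow_eq_zero_iff two_ne_zero |>.mp this
      · rintro rfl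
        refine ⟨by simp, by rw [inv_neg_one]; ring⟩
    rw [this, Finset.sum_singleton]
  by_cases hex : ∃ z : F, z ≠ 0 ∧ z + z⁻¹ = 2 - 4 * lam
  · obtain ⟨z, hz0, hz⟩ := hex
    have hz' : z * z + 1 = (2 - 4 * lam) * z := by rw [← hz]; field_simp
    have hl : lam = -(1 - z) ^ 2 / (4 * z) := by
      rw [eq_div_iff (mul_ne_zero h4 hz0)]; linear_combination hz'
    have hz1 : z ≠ 1 := by
      rintro rfl
      exact hlam (by simpa using hl)
    have hz2 : z ≠ -1 := by
      rintro rfl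
      refine hlam1 ?_
      rw [hl]; field_simp; ring
    have : (Finset.univ.filter fun y : F => y ≠ 0 ∧ y + y⁻¹ = 2 - 4 * lam) = {z, z⁻¹} := by
      ext y
      simp only [Finset.mem_filter, Finset.mem_univ, true_and, Finset.mem_singleton,
        Finset.mem_insert]
      constructor
      · rintro ⟨hy, h⟩
        have h' : y * y + 1 = (2 - 4 * lam) * y := by rw [← h]; field_simp
        have : (y - z) * (y - z⁻¹) = 0 := by
          have hzz : z * z⁻¹ = 1 := mul_inv_cancel₀ hz0
          linear_combination h' - y * hz + hzz
        rcases mul_eq_zero.mp this with h | h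
        · exact Or.inl (sub_eq_zero.mp h)
        · exact Or.inr (sub_eq_zero.mp h)
      · rintro (rfl | rfl)
        · exact ⟨hz0, hz⟩
        · exact ⟨inv_ne_zero hz0, by rw [inv_inv, add_comm, hz]⟩
    have hne : z ≠ z⁻¹ := by
      intro h
      have : (z - 1) * (z + 1) = 0 := by
        have hzz : z * z⁻¹ = 1 := mul_inv_cancel₀ hz0
        linear_combination z * h + hzz
      rcases mul_eq_zero.mp this with h | h
      · exact hz1 (sub_eq_zero.mp h)
      · exact hz2 (by linear_combination h)
    rw [this, Finset.sum_pair hne, sum_period_split hF C hz0 hz1 hz2 hl]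
  · rw [sum_period_eq_zero, Finset.filter_eq_empty_iff.mpr fun z _ h => hex ⟨z, h⟩,
      Finset.sum_empty, mul_zero]
    rintro ⟨s, hs⟩
    -- The quadratic for `z` has discriminant `-16λ(1 - λ)`, so a square root `s` of `-λ(1 - λ)`
    -- gives the root.
    refine hex ⟨1 - 2 * lam + 2 * s, ?_, ?_⟩
    · intro h
      have : (1 : F) = 0 := by linear_combination (1 - 2 * lam - 2 * s) * h - 4 * hs
      exact one_ne_zero this
    · have : (1 - 2 * lam + 2 * s)⁻¹ = 1 - 2 * lam - 2 * s :=
        inv_eq_of_mul_eq_one_right (by linear_combination 4 * hs)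
      rw [this]; ring

/-! ### The outer sum at `3/4` -/

lemma sum_period_three_quarters {F : Type*} [Field F] [Fintype F] [DecidableEq F]
    (hF : ringChar F ≠ 2) (h3 : (3 : F) ≠ 0) (C χ : MulChar F ℂ) :
    ∑ y : F, χ⁻¹ y * (χ⁻¹ ^ 2) (1 - y) *
        ∑ x : F, C⁻¹ x * (C * quadCharC F) (1 - x) * C⁻¹ (1 - 3 / 4 * y * x) =
      jacobiSum (quadCharC F * C) C⁻¹ *
        (χ (-27) * ∑ z : F, (C * χ ^ 3) z * (χ⁻¹ ^ 2) (1 - z ^ 3)) := by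
  have h2 : (2 : F) ≠ 0 := Ring.two_ne_zero hF
  have h4 : (4 : F) ≠ 0 := by rw [show (4 : F) = 2 * 2 by norm_num]; exact mul_ne_zero h2 h2
  have inner : ∀ y : F, χ⁻¹ y * (χ⁻¹ ^ 2) (1 - y) *
      ∑ x : F, C⁻¹ x * (C * quadCharC F) (1 - x) * C⁻¹ (1 - 3 / 4 * y * x) =
      jacobiSum (quadCharC F * C) C⁻¹ *
        ∑ z ∈ Finset.univ.filter (fun z : F => z ≠ 0) with (2 - (z + z⁻¹)) / 3 = y,
          C z * (χ⁻¹ ((2 - (z + z⁻¹)) / 3) * (χ⁻¹ ^ 2) (1 - (2 - (z + z⁻¹)) / 3)) := by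
    intro y
    have hconst : ∑ z ∈ Finset.univ.filter (fun z : F => z ≠ 0) with (2 - (z + z⁻¹)) / 3 = y,
          C z * (χ⁻¹ ((2 - (z + z⁻¹)) / 3) * (χ⁻¹ ^ 2) (1 - (2 - (z + z⁻¹)) / 3)) =
        ∑ z ∈ Finset.univ.filter (fun z : F => z ≠ 0) with (2 - (z + z⁻¹)) / 3 = y,
          C z * (χ⁻¹ y * (χ⁻¹ ^ 2) (1 - y)) :=
      Finset.sum_congr rfl fun z hz => by rw [(Finset.mem_filter.mp hz).2]
    rw [hconst, ← Finset.sum_mul]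
    rcases eq_or_ne y 0 with rfl | hy
    -- At `y = 0` the evaluation `sum_period_eq` does not apply, but the factor `χ⁻¹ y` vanishes.
    · simp [MulChar.map_zero]
    have hlam : (3 / 4 * y : F) ≠ 0 := mul_ne_zero (div_ne_zero h3 h4) hy
    have hfil : (Finset.univ.filter fun z : F => z ≠ 0).filter
        (fun z => (2 - (z + z⁻¹)) / 3 = y) =
        Finset.univ.filter fun z : F => z ≠ 0 ∧ z + z⁻¹ = 2 - 4 * (3 / 4 * y) := by
      rw [Finset.filter_filter]
      refine Finset.filter_congr fun z _ => and_congr_right fun _ => ?_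
      rw [div_eq_iff h3, show 4 * (3 / 4 * y) = y * 3 by field_simp]
      constructor <;> intro h <;> linear_combination -h
    rw [sum_period_eq hF C hlam, hfil]
    ring
  rw [Finset.sum_congr rfl fun y _ => inner y, ← Finset.mul_sum, Finset.sum_fiberwise,
    Finset.sum_filter]
  congr 1
  rw [Finset.mul_sum]
  refine Finset.sum_congr rfl fun z _ => ?_
  rcases eq_or_ne z 0 with rfl | hz
  · simp [MulChar.map_zero]
  rw [if_pos hz]
  simp only [MulChar.mul_apply, MulChar.pow_apply' _ two_ne_zero, MulChar.pow_apply' _ three_ne_zero]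
  have hprod : (2 - (z + z⁻¹)) / 3 * (1 - (2 - (z + z⁻¹)) / 3) ^ 2 =
      (-27 * z ^ 3)⁻¹ * (1 - z ^ 3) ^ 2 := by
    rw [show (-27 : F) = -(3 ^ 3) by norm_num]
    field_simp
    ring
  rw [← map_pow χ⁻¹, ← map_mul χ⁻¹, hprod, map_mul χ⁻¹, MulChar.inv_apply' χ (-27 * z ^ 3)⁻¹,
    inv_inv, map_mul, map_pow, map_pow]
  ring

/-- Counting cube roots of `w = z³` gives the sums `J(Bχ, χ⁻²)`, and the reflection `J(a, b) = a(-1)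
J(a, (ab)⁻¹)` turns each into `J(Bχ, B⁻¹χ)` up to sign. -/
lemma sum_cube_eq_sum_cubeFiber {F : Type*} [Field F] [Fintype F]
    {η : MulChar F ℂ} (hη : orderOf η = 3) {ω : F} (hω1 : ω ≠ 1) (hω : ω ^ 2 + ω + 1 = 0)
    (A χ : MulChar F ℂ) :
    ∑ z : F, (A ^ 3 * χ ^ 3) z * (χ⁻¹ ^ 2) (1 - z ^ 3) =
      χ (-1) * (A (-1) * ∑ B ∈ cubeFiber A, jacobiSum (B * χ) (B⁻¹ * χ)) := by
  have hJ : ∀ B ∈ cubeFiber A,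
      A (-1) * jacobiSum (B * χ) (B⁻¹ * χ) = χ (-1) * jacobiSum (B * χ) (χ⁻¹ ^ 2) := by
    intro B hB
    have e : (B * χ * (B⁻¹ * χ))⁻¹ = χ⁻¹ ^ 2 := by
      rw [mul_mul_mul_comm, mul_inv_cancel, one_mul, mul_inv, sq]
    have hsq : A (-1) * A (-1) = 1 := by rw [← map_mul]; norm_num
    rw [jacobiSum_eq_apply_neg_one_mul, e, MulChar.mul_apply, cubeFiber_apply_neg_one hB]
    linear_combination χ (-1) * jacobiSum (B * χ) (χ⁻¹ ^ 2) * hsq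
  have hsq : χ (-1) * χ (-1) = 1 := by rw [← map_mul]; norm_num
  rw [Finset.mul_sum, Finset.sum_congr rfl hJ, ← Finset.mul_sum, ← mul_assoc, hsq, one_mul,
    sum_cubeFiber hη]
  have hpow : ∀ z : F, (A ^ 3 * χ ^ 3) z * (χ⁻¹ ^ 2) (1 - z ^ 3) =
      (A * χ) (z ^ 3) * (χ⁻¹ ^ 2) (1 - z ^ 3) := fun z => by
    rw [← mul_pow, MulChar.pow_apply' _ three_ne_zero, map_pow]
  rw [Finset.sum_congr rfl fun z _ => hpow z,
    sum_comp_pow_three hη hω1 hω (fun w => (A * χ) w * (χ⁻¹ ^ 2) (1 - w))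
      (by simp [MulChar.map_zero])]
  simp only [jacobiSum, ← Finset.sum_add_distrib]
  refine Finset.sum_congr rfl fun w _ => ?_
  simp only [MulChar.mul_apply]
  ring

/-- This factor occurs both in the period and in the normalization, and must be cancelled. -/
lemma jacobiSum_quadCharC_mul_ne_zero {F : Type*} [Field F] [Fintype F] [DecidableEq F]
    (hF : ringChar F ≠ 2) {C : MulChar F ℂ} (hC : C ^ 2 ≠ 1) :
    jacobiSum (quadCharC F * C) C⁻¹ ≠ 0 := by
  have hφ : quadCharC F ≠ 1 :=
    (MulChar.ringHomComp_ne_one_iff (RingHom.injective_int (Int.castRingHom ℂ))).mpr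
      (quadraticChar_ne_one hF)
  have hφ2 : quadCharC F * quadCharC F = 1 := by
    nth_rewrite 1 [← quadCharC_eq_inv]
    exact inv_mul_cancel _
  have hC1 : C⁻¹ ≠ 1 := fun h => hC (by rw [inv_eq_one.mp h, one_pow])
  have hφC : quadCharC F * C ≠ 1 := by
    intro h
    apply hC
    have : (quadCharC F * C) ^ 2 = 1 := by rw [h, one_pow]
    rwa [mul_pow, sq (quadCharC F), hφ2, one_mul] at this
  have hchar : ringChar ℂ ≠ ringChar F := by
    rw [ringChar.eq_zero]
    exact (CharP.ringChar_ne_zero_of_finite F).symm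
  have := jacobiSum_mul_jacobiSum_inv hchar hφC hC1 (by rwa [mul_inv_cancel_right])
  exact left_ne_zero_of_mul (this.trans_ne (Nat.cast_ne_zero.mpr Fintype.card_ne_zero))

/-! ### Assembly -/

theorem mainTheorem5 {F : Type*} [Field F] [Fintype F] [DecidableEq F]
    (hq : Fintype.card F ≡ 1 [MOD 6])
    (A χ η₃ : MulChar F ℂ) (hη₃ : orderOf η₃ = 3)
    (hA : A ^ 6 ≠ 1) (hχ : χ ^ 6 ≠ 1)
    (hAχ : (A * χ) ^ 3 ≠ 1) (hAχ' : (A⁻¹ * χ) ^ 3 ≠ 1) :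
    ffHyp 2 ![A ^ 3, A⁻¹ ^ 3, χ⁻¹] ![quadCharC F, χ⁻¹ ^ 3] (3 / 4 : F) =
        ∑ B ∈ cubeFiber A,
          (jacobiSum (B * χ) η₃ * jacobiSum (B⁻¹ * χ) η₃⁻¹) /
            (jacobiSum B (χ * η₃) * jacobiSum B⁻¹ (χ * η₃⁻¹)) ∧
      ∑ B ∈ cubeFiber A,
          (jacobiSum (B * χ) η₃ * jacobiSum (B⁻¹ * χ) η₃⁻¹) /
            (jacobiSum B (χ * η₃) * jacobiSum B⁻¹ (χ * η₃⁻¹)) =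
        A (-1) * ∑ B ∈ cubeFiber A,
          jacobiSum (B * χ) (B⁻¹ * χ) / jacobiSum (η₃ * χ) (χ * η₃⁻¹) := by
  have hη3 : η₃ ^ 3 = 1 := by rw [← hη₃, pow_orderOf_eq_one]
  have hη1 : η₃ (-1) = 1 := MulChar.val_neg_one_eq_one_of_odd_order (n := 3) (by decide) hη3
  have hηne : η₃ ≠ 1 := fun h => by simp [h] at hη₃
  have hχ1 : χ ≠ 1 := fun h => hχ (by rw [h, one_pow])
  have hχ2 : χ ^ 2 ≠ 1 := fun h => hχ (by rw [show 6 = 2 * 3 from rfl, pow_mul, h, one_pow])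
  have hχ3 : χ ^ 3 ≠ 1 := fun h => hχ (by rw [show 6 = 3 * 2 from rfl, pow_mul, h, one_pow])
  have hA3 : A ^ 3 ≠ 1 := fun h => hA (by rw [show 6 = 3 * 2 from rfl, pow_mul, h, one_pow])
  have hF : ringChar F ≠ 2 := by
    intro h
    have := FiniteField.even_card_of_char_two h
    unfold Nat.ModEq at hq
    omega
  have hdvd : 3 ∣ Fintype.card F - 1 := by
    unfold Nat.ModEq at hq
    omega
  obtain ⟨ω, hω1, hω⟩ := exists_sq_add_self_add_one_eq_zero (F := F) hdvd
  have h3 : (3 : F) ≠ 0 := by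
    intro h
    -- In characteristic 3, `ω² + ω + 1 = (ω - 1)²`.
    have : (ω - 1) ^ 2 = 0 := by linear_combination hω - ω * h
    exact hω1 (sub_eq_zero.mp (pow_eq_zero_iff two_ne_zero |>.mp this))
  have second : ∑ B ∈ cubeFiber A,
          (jacobiSum (B * χ) η₃ * jacobiSum (B⁻¹ * χ) η₃⁻¹) /
            (jacobiSum B (χ * η₃) * jacobiSum B⁻¹ (χ * η₃⁻¹)) =
        A (-1) * ∑ B ∈ cubeFiber A,
          jacobiSum (B * χ) (B⁻¹ * χ) / jacobiSum (η₃ * χ) (χ * η₃⁻¹) := by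
    rw [Finset.mul_sum]
    refine Finset.sum_congr rfl fun B hB => ?_
    have hB3 : B ^ 3 = A ^ 3 := by simpa [cubeFiber] using hB
    -- Cubing removes `η₃` and replaces `B` by `A`, so the nontriviality conditions involving `B` or
    -- `η₃` reduce to the hypotheses on `A` and `χ`.
    have hcube : ∀ C D : MulChar F ℂ, C ^ 3 = D → D ≠ 1 → C ≠ 1 := fun C D h hD hC =>
      hD (by rw [← h, hC, one_pow])
    rw [jacobiSum_ratio_eq hηne (hcube B _ hB3 hA3)
      (hcube _ _ (by rw [mul_pow, hη3, mul_one]) hχ3)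
      (hcube _ _ (by rw [mul_pow, inv_pow, hη3, inv_one, mul_one]) hχ3) hχ2
      (hcube _ _ (by rw [mul_pow, mul_pow, hη3, hB3, mul_one, mul_pow]) hAχ)
      (hcube _ _ (by rw [mul_pow, mul_pow, inv_pow, inv_pow, hη3, hB3, inv_one, mul_one, mul_pow,
        inv_pow]) hAχ'), hη1, one_mul, cubeFiber_apply_neg_one hB]
  refine ⟨?_, second⟩
  rw [second]
  have hχinv : χ⁻¹⁻¹ * χ⁻¹ ^ 3 = χ⁻¹ ^ 2 := by
    rw [pow_succ' χ⁻¹ 2, inv_mul_cancel_left]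
  have hperiod : ffPeriod 2 ![A ^ 3, A⁻¹ ^ 3, χ⁻¹] ![quadCharC F, χ⁻¹ ^ 3] (3 / 4 : F) =
      ∑ y : F, χ⁻¹ y * (χ⁻¹ ^ 2) (1 - y) *
        ∑ x : F, (A ^ 3)⁻¹ x * (A ^ 3 * quadCharC F) (1 - x) *
          (A ^ 3)⁻¹ (1 - 3 / 4 * y * x) := by
    have hrfl : ffPeriod 2 ![A ^ 3, A⁻¹ ^ 3, χ⁻¹] ![quadCharC F, χ⁻¹ ^ 3] (3 / 4 : F) =
        ∑ y : F, χ⁻¹ y * (χ⁻¹⁻¹ * χ⁻¹ ^ 3) (1 - y) *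
          ∑ x : F, (A⁻¹ ^ 3) x * ((A⁻¹ ^ 3)⁻¹ * quadCharC F) (1 - x) *
            (A ^ 3)⁻¹ (1 - 3 / 4 * y * x) := rfl
    rw [hrfl, hχinv, inv_pow A, inv_inv]
  have hden : ∏ i : Fin 2, jacobiSum (![A ^ 3, A⁻¹ ^ 3, χ⁻¹] i.succ)
        (![quadCharC F, χ⁻¹ ^ 3] i * (![A ^ 3, A⁻¹ ^ 3, χ⁻¹] i.succ)⁻¹) =
      jacobiSum (quadCharC F * A ^ 3) (A ^ 3)⁻¹ * jacobiSum χ⁻¹ (χ⁻¹ ^ 2) := by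
    rw [Fin.prod_univ_two, jacobiSum_comm (quadCharC F * A ^ 3), ← hχinv, mul_comm χ⁻¹⁻¹]
    simp
  have hne := jacobiSum_quadCharC_mul_ne_zero hF (C := A ^ 3) (by rwa [← pow_mul])
  have h27 : χ (-27) = χ (-1) * χ 27 := by rw [← map_mul]; norm_num
  have hsq : χ (-1) * χ (-1) = 1 := by rw [← map_mul]; norm_num
  have h27' : χ 27 ≠ 0 := by
    refine MulChar.apply_ne_zero_iff.mpr (IsUnit.mk0 _ ?_)
    rw [show (27 : F) = 3 ^ 3 by norm_num]
    exact pow_ne_zero 3 h3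
  rw [ffHyp, hden, hperiod, sum_period_three_quarters hF h3,
    sum_cube_eq_sum_cubeFiber hη₃ hω1 hω, jacobiSum_triplication hF h3 hη₃ hω1 hω hχ1, h27,
    ← Finset.sum_div]
  field_simp
  linear_combination A (-1) * (∑ B ∈ cubeFiber A, jacobiSum (B * χ) (B⁻¹ * χ)) *
    (jacobiSum (η₃ * χ) (χ * η₃⁻¹))⁻¹ * hsq
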